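/- Let $n,m,r,p\ge 0$ be integers and let $A,Q,A_0^i\in\mathbb R^{n\times n}$, $B,L,B_0^i\in\mathbb R^{n\times m}$ $(1\le i\le r)$, $R\in\mathbb R^{m\times m}$ be such that $$R\succ 0,\qquad \begin{bmatrix} Q & L\\ L^{\mathsf T} & R\end{bmatrix}\succeq 0 .$$ Here $\succeq,\succ$ refer to the usual (Loewner) partial order on real symmetric matrices. For $X\in\mathbb R^{n\times n}$ put $\Pi_{11}(X)=\sum_i (A_0^i)^{\mathsf T}XA_0^i$, $\Pi_{12}(X)=\sum_i (A_0^i)^{\mathsf T}XB_0^i$, $\Pi_{21}(X)=\sum_i (B_0^i)^{\mathsf T}XA_0^i$, $\Pi_{22}(X)=\sum_i (B_0^i)^{\mathsf T}XB_0^i$, $\Pi(X)=\begin{bmatrix}\Pi_{11}(X)&\Pi_{12}(X)\\ \Pi_{21}(X)&\Pi_{22}(X)\end{bmatrix}$, and $$L_{c}(X)=L+\Pi_{12}(X),\quad R_{c}(X)=R+\Pi_{22}(X),\quad A_c(X)=A-BR_c(X)^{-1}L_c(X)^{\mathsf T},\quad G_c(X)=BR_c(X)^{-1}B^{\mathsf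 T},$$ $$\mathscr R(X)=A^{\mathsf T}X+XA+Q+\Pi_{11}(X)-[XB+L_c(X)]\,R_c(X)^{-1}\,[XB+L_c(X)]^{\mathsf T}.$$ Call a real square matrix stable if all its eigenvalues have negative real part. Assume: 1. There is $F\in\mathbb R^{m\times n}$ such that the linear differential equation $\dot S=(A+BF)S+S(A+BF)^{\mathsf T}+\sum_{i=1}^r(A_0^i+B_0^iF)S(A_0^i+B_0^iF)^{\mathsf T}$ on the real symmetric $n\times n$ matrices is exponentially stable. 2. For some $C\in\mathbb R^{p\times n}$ with $C^{\mathsf T}C=Q-LR^{-1}L^{\mathsf T}$ there is $K\in\mathbb R^{n\times p}$ such that, with $\widetilde A=A-BR^{-1}L^{\mathsf T}$ and $\widetilde A_0^i=A_0^i-B_0^iR^{-1}L^{\mathsf T}$, the linear differential equation $\dot S=(\widetilde A+KC)S+S(\widetilde A+KC)^{\mathsf T}+\sum_{i=1}^r\widetilde A_0^iS(\widetilde A_0^i)^{\mathsf T}$ on the real symmetric $n\times n$ matrices is exponentially stable. 3. $\ker(Q-LR^{-1}L^{\mathsf T})\subseteq\ker L^{\mathsf T}\cap\bigcap_{i=1}^r\ker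 A_0^i$. 4. $(A,B)$ is stabilizable ($A+BF'$ is stable for some $F'$), and $(Q-LR^{-1}L^{\mathsf T},A)$ is detectable ($A+K'(Q-LR^{-1}L^{\mathsf T})$ is stable for some $K'$). Let $X_*\succeq 0$ be a solution of $\mathscr R(X)=0$ (under 1 and 2 there is exactly one positive semidefinite solution). Let $(X_k)_{k\ge 0}$ be a sequence of real $n\times n$ matrices generated by the modified Newton method with each step solved exactly, i.e., for all $k\ge0$, $$\widehat A_k^{\mathsf T}X_{k+1}+X_{k+1}\widehat A_k+P_k^{\mathsf T}\,\Pi(X_k)\,P_k+P_k^{\mathsf T}\begin{bmatrix}Q&L\\L^{\mathsf T}&R\end{bmatrix}P_k=0,$$ where $$\widehat A_k=A_c(X_k)-G_c(X_k)X_k,\qquad P_k=\begin{bmatrix}I\\-R_c(X_k)^{-1}[X_kB+L_c(X_k)]^{\mathsf T}\end{bmatrix}.$$ Suppose that $X_0\succeq X_*$, that $A_c(X_0)-G_c(X_0)X_0$ is stable, that $\mathscr R(X_0)\preceq 0$, and that $X_k\succeq 0$ for all $k$. Then (a) $X_k\succeq X_{k+1}$, $X_k\succeq X_*$ and $\mathscr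 R(X_k)\preceq 0$ for all $k\ge 0$; (b) $\lim_{k\to\infty}X_k=X_*$. -/

import Mathlib

open Filter Topology Matrix

/-- Coefficient data of a stochastic continuous-time algebraic Riccati equation:
`A, Q, A0 i` are `n × n`, `B, L, B0 i` are `n × m`, and `R` is `m × m`. -/
structure SCARE (n m r : ℕ) where
  A : Matrix (Fin n) (Fin n) ℝ
  B : Matrix (Fin n) (Fin m) ℝ
  A0 : Fin r → Matrix (Fin n) (Fin n) ℝ
  B0 : Fin r → Matrix (Fin n) (Fin m) ℝ
  Q : Matrix (Fin n) (Fin n) ℝ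
  L : Matrix (Fin n) (Fin m) ℝ
  R : Matrix (Fin m) (Fin m) ℝ

/-- The real square matrix `M` is stable: all its complex eigenvalues have negative real part. -/
def StableMatrix {n : ℕ} (M : Matrix (Fin n) (Fin n) ℝ) : Prop :=
  ∀ μ ∈ spectrum ℂ (M.map (algebraMap ℝ ℂ)), μ.re < 0

/-- The pair `(A, B)` is stabilizable. -/
def StabilizablePair {n m : ℕ} (A : Matrix (Fin n) (Fin n) ℝ) (B : Matrix (Fin n) (Fin m) ℝ) :
    Prop :=
  ∃ F : Matrix (Fin m) (Fin n) ℝ, StableMatrix (A + B * F)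

/-- The pair `(C, A)` is detectable. -/
def DetectablePair {n p : ℕ} (C : Matrix (Fin p) (Fin n) ℝ) (A : Matrix (Fin n) (Fin n) ℝ) :
    Prop :=
  ∃ K : Matrix (Fin n) (Fin p) ℝ, StableMatrix (A + K * C)

section ExponentialStability

attribute [local instance] Matrix.frobeniusNormedAddCommGroup Matrix.frobeniusNormedSpace

/-- The differential equation `dS/dt = T S` in the space of real symmetric `n × n` matrices is
exponentially stable (the norm is the Frobenius norm). -/
def ExpStable {n : ℕ} (T : Matrix (Fin n) (Fin n) ℝ → Matrix (Fin n) (Fin n) ℝ) : Prop :=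
  ∃ β c : ℝ, 0 < c ∧
    ∀ S : ℝ → Matrix (Fin n) (Fin n) ℝ, (∀ t, (S t).IsSymm) →
      (∀ t, HasDerivAt S (T (S t)) t) →
        ∀ t₀ t, t₀ ≤ t → ‖S t‖ ≤ β * Real.exp (-c * (t - t₀)) * ‖S t₀‖

end ExponentialStability

/-- The operator `S ↦ M S + S Mᵀ + ∑ i, N i S (N i)ᵀ`. -/
def lyapunovOp {n r : ℕ} (M : Matrix (Fin n) (Fin n) ℝ) (N : Fin r → Matrix (Fin n) (Fin n) ℝ)
    (S : Matrix (Fin n) (Fin n) ℝ) : Matrix (Fin n) (Fin n) ℝ :=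
  M * S + S * Mᵀ + ∑ i, N i * S * (N i)ᵀ

namespace SCARE

variable {n m r : ℕ} (D : SCARE n m r)

/-- The block matrix `[Q L; Lᵀ R]` of the cost functional. -/
def cost : Matrix (Fin n ⊕ Fin m) (Fin n ⊕ Fin m) ℝ :=
  fromBlocks D.Q D.L D.Lᵀ D.R

/-- The Schur complement `Q - L R⁻¹ Lᵀ`. -/
noncomputable def schur : Matrix (Fin n) (Fin n) ℝ :=
  D.Q - D.L * D.R⁻¹ * D.Lᵀ

/-- `(A, A0 1, …, A0 r; B, B0 1, …, B0 r)` is stabilizable. -/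
def StochStabilizable : Prop :=
  ∃ F : Matrix (Fin m) (Fin n) ℝ,
    ExpStable (lyapunovOp (D.A + D.B * F) (fun i => D.A0 i + D.B0 i * F))

/-- `(C; Ã, Ã0 1, …, Ã0 r)` is detectable, where `Ã = A - B R⁻¹ Lᵀ` and
`Ã0 i = A0 i - B0 i R⁻¹ Lᵀ`. -/
def StochDetectable {p : ℕ} (C : Matrix (Fin p) (Fin n) ℝ) : Prop :=
  ∃ K : Matrix (Fin n) (Fin p) ℝ,
    ExpStable (lyapunovOp ((D.A - D.B * D.R⁻¹ * D.Lᵀ) + K * C)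
      (fun i => D.A0 i - D.B0 i * D.R⁻¹ * D.Lᵀ))

def Pi11 (X : Matrix (Fin n) (Fin n) ℝ) : Matrix (Fin n) (Fin n) ℝ :=
  ∑ i, (D.A0 i)ᵀ * X * D.A0 i

def Pi12 (X : Matrix (Fin n) (Fin n) ℝ) : Matrix (Fin n) (Fin m) ℝ :=
  ∑ i, (D.A0 i)ᵀ * X * D.B0 i

def Pi21 (X : Matrix (Fin n) (Fin n) ℝ) : Matrix (Fin m) (Fin n) ℝ :=
  ∑ i, (D.B0 i)ᵀ * X * D.A0 i

def Pi22 (X : Matrix (Fin n) (Fin n) ℝ) : Matrix (Fin m) (Fin m) ℝ :=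
  ∑ i, (D.B0 i)ᵀ * X * D.B0 i

/-- The block matrix `Π(X) = ∑ i, [A0 i, B0 i]ᵀ X [A0 i, B0 i]`. -/
def PiBlock (X : Matrix (Fin n) (Fin n) ℝ) : Matrix (Fin n ⊕ Fin m) (Fin n ⊕ Fin m) ℝ :=
  fromBlocks (D.Pi11 X) (D.Pi12 X) (D.Pi21 X) (D.Pi22 X)

def Lc (X : Matrix (Fin n) (Fin n) ℝ) : Matrix (Fin n) (Fin m) ℝ :=
  D.L + D.Pi12 X

def Rc (X : Matrix (Fin n) (Fin n) ℝ) : Matrix (Fin m) (Fin m) ℝ :=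
  D.R + D.Pi22 X

noncomputable def Ac (X : Matrix (Fin n) (Fin n) ℝ) : Matrix (Fin n) (Fin n) ℝ :=
  D.A - D.B * (D.Rc X)⁻¹ * (D.Lc X)ᵀ

noncomputable def Gc (X : Matrix (Fin n) (Fin n) ℝ) : Matrix (Fin n) (Fin n) ℝ :=
  D.B * (D.Rc X)⁻¹ * D.Bᵀ

/-- The residual `ℛ(X)`, i.e. the left-hand side of the Riccati equation `ℛ(X) = 0`. -/
noncomputable def residual (X : Matrix (Fin n) (Fin n) ℝ) : Matrix (Fin n) (Fin n) ℝ :=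
  D.Aᵀ * X + X * D.A + D.Q + D.Pi11 X
    - (X * D.B + D.L + D.Pi12 X) * (D.R + D.Pi22 X)⁻¹ * (X * D.B + D.L + D.Pi12 X)ᵀ

/-- The closed-loop matrix `Â(X) = Ac(X) - Gc(X) X`. -/
noncomputable def Ahat (X : Matrix (Fin n) (Fin n) ℝ) : Matrix (Fin n) (Fin n) ℝ :=
  D.Ac X - D.Gc X * X

/-- The block column `[I; -Rc(X)⁻¹ S(X)ᵀ]` with `S(X) = X B + Lc(X)`. -/
noncomputable def P (X : Matrix (Fin n) (Fin n) ℝ) : Matrix (Fin n ⊕ Fin m) (Fin n) ℝ :=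
  fromRows 1 (-((D.Rc X)⁻¹ * (X * D.B + D.Lc X)ᵀ))

/-- `Π̂_W(Z) = P(W)ᵀ Π(Z) P(W)`. -/
noncomputable def PiHat (W Z : Matrix (Fin n) (Fin n) ℝ) : Matrix (Fin n) (Fin n) ℝ :=
  (D.P W)ᵀ * D.PiBlock Z * D.P W

/-- `M(X) = P(X)ᵀ [Q L; Lᵀ R] P(X)`. -/
noncomputable def M (X : Matrix (Fin n) (Fin n) ℝ) : Matrix (Fin n) (Fin n) ℝ :=
  (D.P X)ᵀ * D.cost * D.P X

/-- `X` is a sequence of iterates of the modified Newton method, every Lyapunov equation being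
solved exactly: `Â(X k)ᵀ X (k+1) + X (k+1) Â(X k) + Π̂_{X k}(X k) + M(X k) = 0`. -/
def IsModifiedNewton (X : ℕ → Matrix (Fin n) (Fin n) ℝ) : Prop :=
  ∀ k, (D.Ahat (X k))ᵀ * X (k + 1) + X (k + 1) * D.Ahat (X k)
    + D.PiHat (X k) (X k) + D.M (X k) = 0

/-- `ker (Q - L R⁻¹ Lᵀ) ⊆ ker Lᵀ ∩ ⋂ i, ker (A0 i)`. -/
def KernelCondition : Prop :=
  ∀ z : Fin n → ℝ, D.schur *ᵥ z = 0 → D.Lᵀ *ᵥ z = 0 ∧ ∀ i, D.A0 i *ᵥ z = 0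

end SCARE

/-! For a feedback `F`, let 𝓛_F be the adjoint Lyapunov operator of the closed loop, noise included.
Everything rests on completion of the square, `closedLoopAdj_add_costAt`: 𝓛_F(X) + cost(F) equals
ℛ(X) plus a positive semidefinite square that vanishes at `F = gain X`. Inserted into the Newton
equation, it gives X_k - X_{k+1}, X_{k+1} - X_* and -ℛ(X_{k+1}) in terms of quantities of known
sign.

Turning these identities into Loewner inequalities requires inverting Lyapunov inequalities. A
strict certificate, Y ≻ 0 with 𝓛(Y) ≺ 0, suffices (`posSemidef_of_neg_lyapunovAdj`). It comes afresh
from each X ⪰ 0 with ℛ(X) ⪯ 0 (`exists_certificate`): X is already a weak certificate, and where it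
fails to be strict the cost vanishes, so by the kernel condition feedback and noise vanish too.
There the loop acts like the detectability-stabilized matrix, whose Lyapunov matrix W is strict;
Finsler's lemma makes W + cX strict everywhere.

The decreasing sequence has a limit Z ⪰ X_*. Since ℛ(X_k) is the Lyapunov image of X_k - X_{k+1} →
0, Z solves the Riccati equation, and comparison in the closed loop of X_* gives Z ⪯ X_*. -/

/-! ### Real quadratic forms. -/

theorem Matrix.posSemidef_iff_real {n : ℕ} {Z : Matrix (Fin n) (Fin n) ℝ} :
    Z.PosSemidef ↔ Zᵀ = Z ∧ ∀ x : Fin n → ℝ, 0 ≤ x ⬝ᵥ Z *ᵥ x := by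
  simp [posSemidef_iff_dotProduct_mulVec, IsHermitian, conjTranspose_eq_transpose_of_trivial]

theorem Matrix.posDef_iff_real {n : ℕ} {Z : Matrix (Fin n) (Fin n) ℝ} :
    Z.PosDef ↔ Zᵀ = Z ∧ ∀ x : Fin n → ℝ, x ≠ 0 → 0 < x ⬝ᵥ Z *ᵥ x := by
  simp [posDef_iff_dotProduct_mulVec, IsHermitian, conjTranspose_eq_transpose_of_trivial]

theorem Matrix.PosSemidef.transpose_eq {n : ℕ} {Z : Matrix (Fin n) (Fin n) ℝ}
    (h : Z.PosSemidef) : Zᵀ = Z := (posSemidef_iff_real.1 h).1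

theorem Matrix.PosDef.transpose_eq {n : ℕ} {Z : Matrix (Fin n) (Fin n) ℝ}
    (h : Z.PosDef) : Zᵀ = Z := (posDef_iff_real.1 h).1

theorem Matrix.PosSemidef.quadForm_nonneg {n : ℕ} {Z : Matrix (Fin n) (Fin n) ℝ}
    (h : Z.PosSemidef) (x : Fin n → ℝ) : 0 ≤ x ⬝ᵥ Z *ᵥ x := (posSemidef_iff_real.1 h).2 x

theorem Matrix.PosDef.quadForm_pos {n : ℕ} {Z : Matrix (Fin n) (Fin n) ℝ}
    (h : Z.PosDef) {x : Fin n → ℝ} (hx : x ≠ 0) : 0 < x ⬝ᵥ Z *ᵥ x := (posDef_iff_real.1 h).2 x hx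

theorem Matrix.PosSemidef.mulVec_eq_zero {n : ℕ} {Z : Matrix (Fin n) (Fin n) ℝ}
    (h : Z.PosSemidef) {x : Fin n → ℝ} (hx : x ⬝ᵥ Z *ᵥ x = 0) : Z *ᵥ x = 0 :=
  (h.dotProduct_mulVec_zero_iff x).1 (by simpa using hx)

theorem Matrix.PosSemidef.transpose_mul_mul {n m : ℕ} {Z : Matrix (Fin n) (Fin n) ℝ}
    (h : Z.PosSemidef) (N : Matrix (Fin n) (Fin m) ℝ) : (Nᵀ * Z * N).PosSemidef := by
  simpa [conjTranspose_eq_transpose_of_trivial] using h.conjTranspose_mul_mul_same N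

theorem Matrix.quadForm_transpose_mul_mul {n m : ℕ} (Z : Matrix (Fin n) (Fin n) ℝ)
    (N : Matrix (Fin n) (Fin m) ℝ) (x : Fin m → ℝ) :
    x ⬝ᵥ (Nᵀ * Z * N) *ᵥ x = (N *ᵥ x) ⬝ᵥ Z *ᵥ (N *ᵥ x) := by
  rw [← mulVec_mulVec, ← mulVec_mulVec, dotProduct_mulVec, vecMul_transpose]

theorem Matrix.continuous_quadForm {n : ℕ} (Z : Matrix (Fin n) (Fin n) ℝ) :
    Continuous fun x : Fin n → ℝ => x ⬝ᵥ Z *ᵥ x := by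
  fun_prop

theorem Matrix.quadForm_smul {n : ℕ} (Z : Matrix (Fin n) (Fin n) ℝ) (a : ℝ) (x : Fin n → ℝ) :
    (a • x) ⬝ᵥ Z *ᵥ (a • x) = a ^ 2 * (x ⬝ᵥ Z *ᵥ x) := by
  simp [mulVec_smul]; ring

theorem Matrix.quadForm_eq_norm_sq_mul {n : ℕ} (Z : Matrix (Fin n) (Fin n) ℝ) {x : Fin n → ℝ}
    (hx : x ≠ 0) :
    x ⬝ᵥ Z *ᵥ x = ‖x‖ ^ 2 * ((‖x‖⁻¹ • x) ⬝ᵥ Z *ᵥ (‖x‖⁻¹ • x)) := by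
  have : ‖x‖ ≠ 0 := norm_ne_zero_iff.2 hx
  rw [quadForm_smul]
  field_simp

theorem inv_norm_smul_mem_sphere {n : ℕ} {x : Fin n → ℝ} (hx : x ≠ 0) :
    ‖x‖⁻¹ • x ∈ Metric.sphere (0 : Fin n → ℝ) 1 := by
  simp [norm_smul, inv_mul_cancel₀ (norm_ne_zero_iff.2 hx)]

theorem ne_zero_of_mem_sphere_zero_one {n : ℕ} {x : Fin n → ℝ}
    (hx : x ∈ Metric.sphere (0 : Fin n → ℝ) 1) : x ≠ 0 := by
  rintro rfl
  simp at hx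

/-! ### Lyapunov inequalities and Finsler's lemma. -/

/-- The adjoint `Z ↦ Mᵀ Z + Z M + ∑ i, (N i)ᵀ Z N i` of `lyapunovOp M N`. -/
def lyapunovAdj {n r : ℕ} (M : Matrix (Fin n) (Fin n) ℝ) (N : Fin r → Matrix (Fin n) (Fin n) ℝ)
    (Z : Matrix (Fin n) (Fin n) ℝ) : Matrix (Fin n) (Fin n) ℝ :=
  Mᵀ * Z + Z * M + ∑ i, (N i)ᵀ * Z * N i

section lyapunovAdj

variable {n r : ℕ} (M : Matrix (Fin n) (Fin n) ℝ) (N : Fin r → Matrix (Fin n) (Fin n) ℝ)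

theorem lyapunovAdj_add (Y Z : Matrix (Fin n) (Fin n) ℝ) :
    lyapunovAdj M N (Y + Z) = lyapunovAdj M N Y + lyapunovAdj M N Z := by
  simp only [lyapunovAdj, mul_add, add_mul, Finset.sum_add_distrib]
  abel

theorem lyapunovAdj_smul (a : ℝ) (Z : Matrix (Fin n) (Fin n) ℝ) :
    lyapunovAdj M N (a • Z) = a • lyapunovAdj M N Z := by
  simp only [lyapunovAdj, smul_add, Matrix.mul_smul, Matrix.smul_mul, Finset.smul_sum]

theorem lyapunovAdj_sub (Y Z : Matrix (Fin n) (Fin n) ℝ) :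
    lyapunovAdj M N (Y - Z) = lyapunovAdj M N Y - lyapunovAdj M N Z := by
  rw [eq_sub_iff_add_eq, ← lyapunovAdj_add, sub_add_cancel]

theorem lyapunovAdj_transpose {Z : Matrix (Fin n) (Fin n) ℝ} (hZ : Zᵀ = Z) :
    (lyapunovAdj M N Z)ᵀ = lyapunovAdj M N Z := by
  simp only [lyapunovAdj, transpose_add, transpose_mul, transpose_transpose, hZ, transpose_sum,
    Matrix.mul_assoc]
  rw [add_comm (Z * M)]

/-- Symmetry puts the drift `M` opposite `Z *ᵥ x` only, so on the kernel of `Z` just the noise terms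
survive. -/
theorem quadForm_lyapunovAdj {Z : Matrix (Fin n) (Fin n) ℝ} (hZ : Zᵀ = Z) (x : Fin n → ℝ) :
    x ⬝ᵥ lyapunovAdj M N Z *ᵥ x =
      2 * ((Z *ᵥ x) ⬝ᵥ (M *ᵥ x)) + ∑ i, (N i *ᵥ x) ⬝ᵥ Z *ᵥ (N i *ᵥ x) := by
  have h1 : x ⬝ᵥ (Z * M) *ᵥ x = (Z *ᵥ x) ⬝ᵥ (M *ᵥ x) := by
    rw [← mulVec_mulVec, dotProduct_mulVec, ← mulVec_transpose, hZ]
  have h2 : x ⬝ᵥ (Mᵀ * Z) *ᵥ x = (Z *ᵥ x) ⬝ᵥ (M *ᵥ x) := by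
    rw [← mulVec_mulVec, dotProduct_mulVec, vecMul_transpose, dotProduct_comm]
  simp only [lyapunovAdj, add_mulVec, dotProduct_add, h1, h2, sum_mulVec, dotProduct_sum,
    quadForm_transpose_mul_mul]
  ring

/-- A strict Lyapunov certificate `Y` forces supersolutions of the Lyapunov equation to be
positive semidefinite. -/
theorem posSemidef_of_neg_lyapunovAdj {Y Z : Matrix (Fin n) (Fin n) ℝ} (hY : Y.PosDef)
    (hYneg : (-lyapunovAdj M N Y).PosDef) (hZ : Zᵀ = Z)
    (hZneg : (-lyapunovAdj M N Z).PosSemidef) : Z.PosSemidef := by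
  by_contra hcon
  obtain ⟨x, hx⟩ : ∃ x : Fin n → ℝ, x ⬝ᵥ Z *ᵥ x < 0 := by
    by_contra! h
    exact hcon (posSemidef_iff_real.2 ⟨hZ, h⟩)
  have hx0 : x ≠ 0 := by rintro rfl; simp at hx
  -- The minimum t of this generalized Rayleigh quotient is the largest t with Z - tY ⪰ 0, and the
  -- minimizer lies in the kernel of Z - tY.
  let f : (Fin n → ℝ) → ℝ := fun x => (x ⬝ᵥ Z *ᵥ x) / (x ⬝ᵥ Y *ᵥ x)
  have hf : ContinuousOn f (Metric.sphere 0 1) :=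
    (continuous_quadForm Z).continuousOn.div (continuous_quadForm Y).continuousOn
      fun y hy => (hY.quadForm_pos (ne_zero_of_mem_sphere_zero_one hy)).ne'
  obtain ⟨z, hz, hmin⟩ := (isCompact_sphere (0 : Fin n → ℝ) 1).exists_isMinOn
    ⟨_, inv_norm_smul_mem_sphere hx0⟩ hf
  have hz0 := ne_zero_of_mem_sphere_zero_one hz
  have hYz := hY.quadForm_pos hz0
  have hfx : ∀ y, y ≠ 0 → f z * (y ⬝ᵥ Y *ᵥ y) ≤ y ⬝ᵥ Z *ᵥ y := by
    intro y hy
    have h1 : f z ≤ f (‖y‖⁻¹ • y) := hmin (inv_norm_smul_mem_sphere hy)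
    have h2 := hY.quadForm_pos (ne_zero_of_mem_sphere_zero_one (inv_norm_smul_mem_sphere hy))
    rw [le_div_iff₀ h2] at h1
    rw [quadForm_eq_norm_sq_mul Y hy, quadForm_eq_norm_sq_mul Z hy]
    nlinarith [sq_nonneg ‖y‖]
  have hneg : f z < 0 := by
    by_contra! h
    nlinarith [hfx x hx0, hY.quadForm_pos hx0]
  have hP : (Z + (-f z) • Y).PosSemidef := by
    refine posSemidef_iff_real.2 ⟨by simp [hZ, hY.transpose_eq], fun y => ?_⟩
    rcases eq_or_ne y 0 with rfl | hy
    · simp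
    · have := hfx y hy
      simp only [add_mulVec, smul_mulVec, dotProduct_add, dotProduct_smul, smul_eq_mul]
      linarith
  have hPz : (Z + (-f z) • Y) *ᵥ z = 0 := by
    apply hP.mulVec_eq_zero
    simp only [add_mulVec, smul_mulVec, dotProduct_add, dotProduct_smul, smul_eq_mul, f]
    field_simp
    ring
  -- At `z` the form of 𝓛(Z - tY) is a sum of nonnegative noise terms. But 𝓛(Z) ⪯ 0, 𝓛(Y) ≺ 0 and t
  -- < 0 make it negative.
  have h1 := quadForm_lyapunovAdj M N hP.transpose_eq z
  have h2 := Finset.sum_nonneg fun i (_ : i ∈ Finset.univ) => hP.quadForm_nonneg (N i *ᵥ z)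
  rw [hPz, zero_dotProduct, mul_zero, zero_add] at h1
  rw [← h1, lyapunovAdj_add, lyapunovAdj_smul] at h2
  have h3 := hYneg.quadForm_pos hz0
  have h4 := hZneg.quadForm_nonneg z
  simp only [add_mulVec, smul_mulVec, neg_mulVec, dotProduct_add, dotProduct_smul,
    dotProduct_neg, smul_eq_mul] at h2 h3 h4
  nlinarith

end lyapunovAdj

/-- Finsler's lemma. -/
theorem Matrix.PosSemidef.exists_smul_sub_posDef {n : ℕ} {P S : Matrix (Fin n) (Fin n) ℝ}
    (hP : P.PosSemidef) (hS : Sᵀ = S)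
    (h : ∀ x : Fin n → ℝ, x ≠ 0 → x ⬝ᵥ P *ᵥ x = 0 → x ⬝ᵥ S *ᵥ x < 0) :
    ∃ c : ℝ, 0 ≤ c ∧ (c • P - S).PosDef := by
  suffices ∃ c : ℝ, 0 ≤ c ∧ ∀ x ∈ Metric.sphere (0 : Fin n → ℝ) 1,
      x ⬝ᵥ S *ᵥ x < c * (x ⬝ᵥ P *ᵥ x) by
    obtain ⟨c, hc, hx⟩ := this
    refine ⟨c, hc, posDef_iff_real.2 ⟨by simp [hS, hP.transpose_eq], fun x hx0 => ?_⟩⟩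
    rw [quadForm_eq_norm_sq_mul _ hx0]
    have := hx _ (inv_norm_smul_mem_sphere hx0)
    refine mul_pos (by positivity) ?_
    rw [sub_mulVec, smul_mulVec, dotProduct_sub, dotProduct_smul, smul_eq_mul]
    linarith
  -- Only unit vectors with nonnegative `S`-form need help from `P`. On this compact set `P` is
  -- bounded below by a positive minimum, so c = (max S + 1) / min P works.
  set K := Metric.sphere (0 : Fin n → ℝ) 1 ∩ {x | 0 ≤ x ⬝ᵥ S *ᵥ x} with hK
  have hKc : IsCompact K := (isCompact_sphere _ _).inter_right
    (isClosed_le continuous_const (continuous_quadForm S))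
  rcases K.eq_empty_or_nonempty with hKe | hKn
  · refine ⟨0, le_rfl, fun x hx => ?_⟩
    by_contra! hcon
    have : x ∈ K := ⟨hx, by simpa using hcon⟩
    simp [hKe] at this
  obtain ⟨z, hz, hmin⟩ := hKc.exists_isMinOn hKn (continuous_quadForm P).continuousOn
  obtain ⟨w, hw, hmax⟩ := hKc.exists_isMaxOn hKn (continuous_quadForm S).continuousOn
  have hd : 0 < z ⬝ᵥ P *ᵥ z := by
    refine lt_of_le_of_ne (hP.quadForm_nonneg z) fun h0 => ?_
    exact absurd (h z (ne_zero_of_mem_sphere_zero_one hz.1) h0.symm) (not_lt.2 hz.2)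
  have hw0 : 0 ≤ w ⬝ᵥ S *ᵥ w := hw.2
  refine ⟨(w ⬝ᵥ S *ᵥ w + 1) / (z ⬝ᵥ P *ᵥ z), by positivity, fun x hx => ?_⟩
  by_cases hxK : 0 ≤ x ⬝ᵥ S *ᵥ x
  · have h1 : x ⬝ᵥ S *ᵥ x ≤ w ⬝ᵥ S *ᵥ w := hmax ⟨hx, hxK⟩
    have h2 : z ⬝ᵥ P *ᵥ z ≤ x ⬝ᵥ P *ᵥ x := hmin ⟨hx, hxK⟩
    calc x ⬝ᵥ S *ᵥ x < w ⬝ᵥ S *ᵥ w + 1 := by linarith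
      _ = (w ⬝ᵥ S *ᵥ w + 1) / (z ⬝ᵥ P *ᵥ z) * (z ⬝ᵥ P *ᵥ z) := by field_simp
      _ ≤ _ := by gcongr
  · exact (not_le.1 hxK).trans_le (mul_nonneg (by positivity) (hP.quadForm_nonneg x))

/-! ### Lyapunov's theorem through the Cayley transform. -/

section
open scoped Matrix.Norms.L2Operator

/-- Gelfand's formula: ‖T^N‖^(1/N) tends to the spectral radius, which is below 1. -/
theorem exists_norm_pow_lt_one_of_spectrum {n : ℕ} (T : Matrix (Fin n) (Fin n) ℂ)
    (hT : ∀ μ ∈ spectrum ℂ T, ‖μ‖ < 1) : ∃ N : ℕ, N ≠ 0 ∧ ‖T ^ N‖ < 1 := by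
  rcases isEmpty_or_nonempty (Fin n) with h | h
  · exact ⟨1, one_ne_zero, by rw [Subsingleton.elim (T ^ 1) 0]; simp⟩
  have h1 : spectralRadius ℂ T < 1 :=
    spectrum.spectralRadius_lt_of_forall_lt T (r := 1) fun k hk => by
      exact_mod_cast hT k hk
  have h2 := spectrum.pow_nnnorm_pow_one_div_tendsto_nhds_spectralRadius T
  obtain ⟨N, hN, hN0⟩ := ((h2.eventually_lt_const h1).and (eventually_ne_atTop 0)).exists
  refine ⟨N, hN0, ?_⟩
  by_contra! hcon
  refine absurd hN (not_lt.2 (ENNReal.one_le_rpow ?_ (by positivity)))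
  exact_mod_cast hcon

theorem posDef_one_sub_transpose_mul_self {n : ℕ} (T : Matrix (Fin n) (Fin n) ℝ)
    (hT : ‖T.map (algebraMap ℝ ℂ)‖ < 1) : (1 - Tᵀ * T).PosDef := by
  refine posDef_iff_real.2 ⟨by simp, fun x hx => ?_⟩
  have key : ∀ v : Fin n → ℝ, v ⬝ᵥ v = ‖WithLp.toLp 2 (fun i => (v i : ℂ))‖ ^ 2 := by
    intro v
    rw [EuclideanSpace.norm_sq_eq]
    simp [dotProduct, sq]
  have h1 := l2_opNorm_mulVec (T.map (algebraMap ℝ ℂ)) (WithLp.toLp 2 (fun i => (x i : ℂ)))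
  have h2 : (T.map (algebraMap ℝ ℂ)) *ᵥ (fun i => (x i : ℂ)) = fun i => ((T *ᵥ x) i : ℂ) := by
    ext i
    simp [mulVec, dotProduct]
  have h3 : 0 < x ⬝ᵥ x := by
    simpa using (PosDef.one (n := Fin n) (R := ℝ)).quadForm_pos hx
  rw [sub_mulVec, dotProduct_sub, one_mulVec, ← mulVec_mulVec, dotProduct_mulVec, vecMul_transpose]
  simp only [h2] at h1
  rw [key] at h3 ⊢
  rw [key (T *ᵥ x)]
  have h4 : 0 < ‖WithLp.toLp 2 (fun i => (x i : ℂ))‖ := by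
    by_contra! h
    have := norm_nonneg (WithLp.toLp 2 (fun i => (x i : ℂ)))
    rw [le_antisymm h this] at h3
    simp at h3
  have h5 : ‖WithLp.toLp 2 (fun i => ((T *ᵥ x) i : ℂ))‖ < ‖WithLp.toLp 2 (fun i => (x i : ℂ))‖ :=
    h1.trans_lt (by nlinarith)
  nlinarith [norm_nonneg (WithLp.toLp 2 (fun i => ((T *ᵥ x) i : ℂ)))]

end

/-- If some power of `T` is a contraction, then `T` has a strict discrete Lyapunov certificate. -/
theorem exists_posDef_stein {n N : ℕ} (T : Matrix (Fin n) (Fin n) ℝ) (hN : N ≠ 0)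
    (hT : (1 - (T ^ N)ᵀ * T ^ N).PosDef) :
    ∃ W : Matrix (Fin n) (Fin n) ℝ, W.PosDef ∧ (W - Tᵀ * W * T).PosDef := by
  refine ⟨∑ k ∈ Finset.range N, (T ^ k)ᵀ * T ^ k, ?_, ?_⟩
  · obtain ⟨N, rfl⟩ := Nat.exists_eq_succ_of_ne_zero hN
    rw [Finset.sum_range_succ']
    refine PosDef.posSemidef_add (posSemidef_sum _ fun i _ => ?_) (by simpa using PosDef.one)
    simpa using (PosSemidef.one (n := Fin n) (R := ℝ)).transpose_mul_mul (T ^ (i + 1))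
  · have h1 : Tᵀ * (∑ k ∈ Finset.range N, (T ^ k)ᵀ * T ^ k) * T =
        ∑ k ∈ Finset.range N, (T ^ (k + 1))ᵀ * T ^ (k + 1) := by
      rw [Finset.mul_sum, Finset.sum_mul]
      refine Finset.sum_congr rfl fun k _ => ?_
      rw [pow_succ, transpose_mul]
      simp only [Matrix.mul_assoc]
    -- The sum telescopes: W - TᵀWT = 1 - (T^N)ᵀ T^N.
    rw [h1, ← Finset.sum_sub_distrib, Finset.sum_range_sub']
    simpa using hT

theorem isUnit_map_complex {n : ℕ} {T : Matrix (Fin n) (Fin n) ℝ}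
    (h : IsUnit (T.map (algebraMap ℝ ℂ))) : IsUnit T := by
  rw [isUnit_iff_isUnit_det, isUnit_iff_ne_zero] at h ⊢
  rintro h0
  apply h
  have := RingHom.map_det (algebraMap ℝ ℂ) T
  rw [h0, map_zero] at this
  exact this.symm

theorem exists_eigenvector_of_mem_spectrum {n : ℕ} {T : Matrix (Fin n) (Fin n) ℂ} {μ : ℂ}
    (h : μ ∈ spectrum ℂ T) : ∃ v : Fin n → ℂ, v ≠ 0 ∧ T *ᵥ v = μ • v := by
  rw [spectrum.mem_iff, isUnit_iff_isUnit_det, isUnit_iff_ne_zero, not_not] at h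
  obtain ⟨v, hv, h⟩ := exists_mulVec_eq_zero_iff.2 h
  refine ⟨v, hv, ?_⟩
  rw [sub_mulVec, sub_eq_zero, Algebra.algebraMap_eq_smul_one, smul_mulVec, one_mulVec] at h
  exact h.symm

theorem mem_spectrum_of_mulVec {n : ℕ} {T : Matrix (Fin n) (Fin n) ℂ} {μ : ℂ} {v : Fin n → ℂ}
    (hv : v ≠ 0) (h : T *ᵥ v = μ • v) : μ ∈ spectrum ℂ T := by
  rw [spectrum.mem_iff, isUnit_iff_isUnit_det, isUnit_iff_ne_zero, not_not]
  refine exists_mulVec_eq_zero_iff.1 ⟨v, hv, ?_⟩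
  rw [sub_mulVec, sub_eq_zero, Algebra.algebraMap_eq_smul_one, smul_mulVec, one_mulVec, h]

/-- The relation makes (μ - 1)/(μ + 1) an eigenvalue of `M`; its real part is (|μ|² - 1)/|μ + 1|²,
hence |μ| < 1. -/
theorem norm_cayley_lt_one {μ : ℂ} {n : ℕ} {M : Matrix (Fin n) (Fin n) ℂ}
    (hM : ∀ μ ∈ spectrum ℂ M, μ.re < 0) {u : Fin n → ℂ} (hu : u ≠ 0)
    (h : (1 + M) *ᵥ u = μ • ((1 - M) *ᵥ u)) : ‖μ‖ < 1 := by
  have h1 : (1 + μ) • (M *ᵥ u) = (μ - 1) • u := by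
    rw [add_mulVec, sub_mulVec, one_mulVec, smul_sub] at h
    rw [add_smul, sub_smul, one_smul, one_smul, eq_sub_iff_add_eq]
    have := sub_eq_zero.2 h
    rw [← sub_eq_zero, ← this]
    abel
  have h2 : 1 + μ ≠ 0 := by
    intro h0
    rw [h0, zero_smul] at h1
    have h3 := (smul_eq_zero.1 h1.symm).resolve_right hu
    have : (2 : ℂ) = (1 + μ) - (μ - 1) := by ring
    rw [h0, h3] at this
    norm_num at this
  have h3 : ((1 + μ)⁻¹ * (μ - 1)).re < 0 := by
    refine hM _ (mem_spectrum_of_mulVec hu ?_)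
    rw [mul_smul, ← h1, smul_smul, inv_mul_cancel₀ h2, one_smul]
  have h4 : 0 < Complex.normSq (1 + μ) := Complex.normSq_pos.2 h2
  have h5 : ((1 + μ)⁻¹ * (μ - 1)).re = (μ.re ^ 2 + μ.im ^ 2 - 1) / Complex.normSq (1 + μ) := by
    rw [Complex.mul_re, Complex.inv_re, Complex.inv_im]
    simp
    field_simp
    ring
  rw [h5, div_neg_iff] at h3
  have h6 : μ.re ^ 2 + μ.im ^ 2 < 1 := by
    rcases h3 with h3 | h3 <;> linarith [h3.1, h3.2]
  have h7 : ‖μ‖ ^ 2 = μ.re ^ 2 + μ.im ^ 2 := by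
    rw [Complex.sq_norm, Complex.normSq_apply]; ring
  nlinarith [norm_nonneg μ]

/-- Lyapunov's theorem: a stable matrix has a strict Lyapunov certificate. -/
theorem StableMatrix.exists_posDef {n : ℕ} {M : Matrix (Fin n) (Fin n) ℝ} (hM : StableMatrix M) :
    ∃ W : Matrix (Fin n) (Fin n) ℝ, W.PosDef ∧ (-(Mᵀ * W + W * M)).PosDef := by
  set φ : Matrix (Fin n) (Fin n) ℝ →+* Matrix (Fin n) (Fin n) ℂ :=
    (algebraMap ℝ ℂ).mapMatrix with hφ
  have hφ' : ∀ T, φ T = T.map (algebraMap ℝ ℂ) := fun _ => rfl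
  have hU : IsUnit (1 - M) := by
    apply isUnit_map_complex
    rw [← hφ', map_sub, map_one]
    by_contra hcon
    have h1 : (1 : ℂ) ∈ spectrum ℂ (φ M) := by
      rwa [spectrum.mem_iff, map_one]
    have := hM 1 h1
    norm_num at this
  have hdet : IsUnit (1 - M).det := (isUnit_iff_isUnit_det _).1 hU
  have hinv : (1 - M)⁻¹ * (1 - M) = 1 := nonsing_inv_mul _ hdet
  have hinv' : (1 - M) * (1 - M)⁻¹ = 1 := mul_nonsing_inv _ hdet
  -- The Cayley transform carries the open left half-plane to the open unit disc, where powers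
  -- supply a Stein certificate.
  set T := (1 + M) * (1 - M)⁻¹ with hTdef
  have hTM : T * (1 - M) = 1 + M := by rw [hTdef, Matrix.mul_assoc, hinv, Matrix.mul_one]
  have hspec : ∀ μ ∈ spectrum ℂ (φ T), ‖μ‖ < 1 := by
    intro μ hμ
    obtain ⟨v, hv, h⟩ := exists_eigenvector_of_mem_spectrum hμ
    have h2 : (1 - φ M) *ᵥ (φ (1 - M)⁻¹ *ᵥ v) = v := by
      rw [mulVec_mulVec, ← map_one φ, ← map_sub, ← map_mul, hinv', map_one, one_mulVec]
    refine norm_cayley_lt_one (M := φ M) hM (u := φ (1 - M)⁻¹ *ᵥ v) ?_ ?_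
    · intro h0
      rw [h0, mulVec_zero] at h2
      exact hv h2.symm
    · rw [h2, ← h, mulVec_mulVec, hTdef, map_mul, map_add, map_one]
  obtain ⟨N, hN, hlt⟩ := exists_norm_pow_lt_one_of_spectrum (φ T) hspec
  rw [← map_pow] at hlt
  obtain ⟨W, hW, hWT⟩ := exists_posDef_stein T hN (posDef_one_sub_transpose_mul_self _ hlt)
  refine ⟨W, hW, ?_⟩
  -- Congruence by 1 - M turns the Stein expression of `T` into twice the Lyapunov expression of
  -- `M`.
  have h1 : (1 - M)ᵀ * (W - Tᵀ * W * T) * (1 - M) = (2 : ℝ) • -(Mᵀ * W + W * M) := by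
    have : (1 - M)ᵀ * (W - Tᵀ * W * T) * (1 - M) =
        (1 - M)ᵀ * W * (1 - M) - (T * (1 - M))ᵀ * W * (T * (1 - M)) := by
      rw [transpose_mul T]; noncomm_ring
    rw [this, hTM, two_smul, transpose_sub, transpose_add, transpose_one]
    noncomm_ring
  have h2 : ((1 - M)ᵀ * (W - Tᵀ * W * T) * (1 - M)).PosDef := by
    refine posDef_iff_real.2 ⟨?_, fun x hx => ?_⟩
    · exact (hWT.posSemidef.transpose_mul_mul _).transpose_eq
    · rw [quadForm_transpose_mul_mul]
      refine hWT.quadForm_pos fun h0 => hx ?_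
      rw [← one_mulVec x, ← hinv, ← mulVec_mulVec, h0, mulVec_zero]
  rw [h1] at h2
  simpa [smul_smul] using h2.smul (a := (2 : ℝ)⁻¹) (by norm_num)

/-! ### Completion of the square and closed-loop certificates. -/

namespace SCARE

variable {n m r : ℕ} (D : SCARE n m r)

/-- The noise coefficients `A0 i + B0 i F` of the system closed by the feedback `F`. -/
def noise (F : Matrix (Fin m) (Fin n) ℝ) (i : Fin r) : Matrix (Fin n) (Fin n) ℝ :=
  D.A0 i + D.B0 i * F

/-- The cost matrix `[I; F]ᵀ [Q L; Lᵀ R] [I; F]` of the feedback `F`. -/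
def costAt (F : Matrix (Fin m) (Fin n) ℝ) : Matrix (Fin n) (Fin n) ℝ :=
  (fromRows (1 : Matrix (Fin n) (Fin n) ℝ) F)ᵀ * D.cost * fromRows (1 : Matrix (Fin n) (Fin n) ℝ) F

/-- The minimizing feedback `-Rc(X)⁻¹ (X B + Lc(X))ᵀ`. -/
noncomputable def gain (X : Matrix (Fin n) (Fin n) ℝ) : Matrix (Fin m) (Fin n) ℝ :=
  -((D.Rc X)⁻¹ * (X * D.B + D.Lc X)ᵀ)

/-- The adjoint of the generator of the system closed by the feedback `F`. -/
def closedLoopAdj (F : Matrix (Fin m) (Fin n) ℝ) (X : Matrix (Fin n) (Fin n) ℝ) :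
    Matrix (Fin n) (Fin n) ℝ :=
  lyapunovAdj (D.A + D.B * F) (D.noise F) X

theorem fromRows_one_conj (F : Matrix (Fin m) (Fin n) ℝ) (a : Matrix (Fin n) (Fin n) ℝ)
    (b : Matrix (Fin n) (Fin m) ℝ) (c : Matrix (Fin m) (Fin n) ℝ) (d : Matrix (Fin m) (Fin m) ℝ) :
    (fromRows (1 : Matrix (Fin n) (Fin n) ℝ) F)ᵀ * fromBlocks a b c d *
      fromRows (1 : Matrix (Fin n) (Fin n) ℝ) F = a + b * F + Fᵀ * c + Fᵀ * d * F := by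
  rw [transpose_fromRows, fromCols_mul_fromBlocks, fromCols_mul_fromRows]
  simp only [transpose_one, Matrix.one_mul, Matrix.mul_one, Matrix.add_mul]
  abel

theorem costAt_eq (F : Matrix (Fin m) (Fin n) ℝ) :
    D.costAt F = D.Q + D.L * F + Fᵀ * D.Lᵀ + Fᵀ * D.R * F :=
  fromRows_one_conj ..

theorem M_eq (X : Matrix (Fin n) (Fin n) ℝ) : D.M X = D.costAt (D.gain X) := rfl

theorem sum_noise (F : Matrix (Fin m) (Fin n) ℝ) (X : Matrix (Fin n) (Fin n) ℝ) :
    ∑ i, (D.noise F i)ᵀ * X * D.noise F i =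
      D.Pi11 X + D.Pi12 X * F + Fᵀ * D.Pi21 X + Fᵀ * D.Pi22 X * F := by
  simp only [noise, Pi11, Pi12, Pi21, Pi22, Matrix.sum_mul, Matrix.mul_sum,
    ← Finset.sum_add_distrib]
  refine Finset.sum_congr rfl fun i _ => ?_
  rw [transpose_add, transpose_mul]
  simp only [Matrix.add_mul, Matrix.mul_add, Matrix.mul_assoc]
  abel

theorem PiHat_eq (W Z : Matrix (Fin n) (Fin n) ℝ) :
    D.PiHat W Z = ∑ i, (D.noise (D.gain W) i)ᵀ * Z * D.noise (D.gain W) i := by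
  rw [sum_noise]
  exact fromRows_one_conj ..

theorem Ahat_eq {X : Matrix (Fin n) (Fin n) ℝ} (hX : Xᵀ = X) :
    D.Ahat X = D.A + D.B * D.gain X := by
  rw [Ahat, Ac, Gc, gain, transpose_add, transpose_mul, hX]
  simp only [Matrix.mul_neg, Matrix.mul_add, Matrix.mul_assoc]
  abel

theorem posSemidef_Pi22 {X : Matrix (Fin n) (Fin n) ℝ} (hX : X.PosSemidef) :
    (D.Pi22 X).PosSemidef :=
  posSemidef_sum _ fun _ _ => hX.transpose_mul_mul _

theorem posSemidef_sum_noise (F : Matrix (Fin m) (Fin n) ℝ) {X : Matrix (Fin n) (Fin n) ℝ}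
    (hX : X.PosSemidef) : (∑ i, (D.noise F i)ᵀ * X * D.noise F i).PosSemidef :=
  posSemidef_sum _ fun _ _ => hX.transpose_mul_mul _

theorem posSemidef_PiHat (W : Matrix (Fin n) (Fin n) ℝ) {Z : Matrix (Fin n) (Fin n) ℝ}
    (hZ : Z.PosSemidef) : (D.PiHat W Z).PosSemidef := by
  rw [PiHat_eq]
  exact D.posSemidef_sum_noise _ hZ

variable {D}

theorem posDef_Rc (hR : D.R.PosDef) {X : Matrix (Fin n) (Fin n) ℝ} (hX : X.PosSemidef) :
    (D.Rc X).PosDef :=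
  hR.add_posSemidef (D.posSemidef_Pi22 hX)

variable (D) in
theorem Pi12_transpose {X : Matrix (Fin n) (Fin n) ℝ} (hX : Xᵀ = X) :
    (D.Pi12 X)ᵀ = D.Pi21 X := by
  simp only [Pi12, Pi21, transpose_sum, transpose_mul, transpose_transpose, hX, Matrix.mul_assoc]

/-- Completion of the square. -/
theorem closedLoopAdj_add_costAt (hR : D.R.PosDef) {X : Matrix (Fin n) (Fin n) ℝ}
    (hX : X.PosSemidef) (F : Matrix (Fin m) (Fin n) ℝ) :
    D.closedLoopAdj F X + D.costAt F =
      D.residual X + (F - D.gain X)ᵀ * D.Rc X * (F - D.gain X) := by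
  have hRc := posDef_Rc hR hX
  have hdet : IsUnit (D.Rc X).det := isUnit_iff_ne_zero.2 hRc.det_pos.ne'
  have h1 : (D.Rc X)⁻¹ * D.Rc X = 1 := nonsing_inv_mul _ hdet
  have h2 : D.Rc X * (D.Rc X)⁻¹ = 1 := mul_nonsing_inv _ hdet
  have hT : (D.Rc X)⁻¹ᵀ = (D.Rc X)⁻¹ := by rw [transpose_nonsing_inv, hRc.transpose_eq]
  set S := X * D.B + D.Lc X with hS
  have hST : Sᵀ = D.Bᵀ * X + D.Lᵀ + D.Pi21 X := by
    rw [hS, Lc, transpose_add, transpose_add, transpose_mul, hX.transpose_eq,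
      D.Pi12_transpose hX.transpose_eq, add_assoc]
  have hres : D.residual X = D.Aᵀ * X + X * D.A + D.Q + D.Pi11 X - S * (D.Rc X)⁻¹ * Sᵀ := by
    rw [residual, hS, Lc, Rc, add_assoc (X * D.B)]
  have hsq : (F - D.gain X)ᵀ * D.Rc X * (F - D.gain X) =
      Fᵀ * D.Rc X * F + Fᵀ * Sᵀ + S * F + S * (D.Rc X)⁻¹ * Sᵀ := by
    have hg : D.Rc X * (F - D.gain X) = D.Rc X * F + Sᵀ := by
      rw [gain, ← hS, sub_neg_eq_add, Matrix.mul_add, ← Matrix.mul_assoc, h2, Matrix.one_mul]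
    have hg' : (F - D.gain X)ᵀ = Fᵀ + S * (D.Rc X)⁻¹ := by
      rw [gain, ← hS, sub_neg_eq_add, transpose_add, transpose_mul, transpose_transpose, hT]
    rw [Matrix.mul_assoc, hg, hg', Matrix.add_mul, Matrix.mul_add, Matrix.mul_add,
      Matrix.mul_assoc S _ (D.Rc X * F), ← Matrix.mul_assoc (D.Rc X)⁻¹, h1, Matrix.one_mul,
      Matrix.mul_assoc Fᵀ]
    abel
  rw [hres, hsq, closedLoopAdj, lyapunovAdj, sum_noise, costAt_eq, hST, hS, Lc, Rc,
    transpose_add, transpose_mul]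
  simp only [Matrix.add_mul, Matrix.mul_add, Matrix.mul_assoc]
  abel

theorem closedLoopAdj_gain (hR : D.R.PosDef) {X : Matrix (Fin n) (Fin n) ℝ}
    (hX : X.PosSemidef) :
    D.closedLoopAdj (D.gain X) X = D.residual X - D.costAt (D.gain X) := by
  rw [eq_sub_iff_add_eq, closedLoopAdj_add_costAt hR hX]
  simp

theorem posSemidef_costAt (hcost : D.cost.PosSemidef) (F : Matrix (Fin m) (Fin n) ℝ) :
    (D.costAt F).PosSemidef := by
  simpa [costAt, conjTranspose_eq_transpose_of_trivial] using
    hcost.conjTranspose_mul_mul_same (fromRows (1 : Matrix (Fin n) (Fin n) ℝ) F)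

/-- Completing the square in `F` exposes the zero-cost directions: the Schur form vanishes and `F`
acts as -R⁻¹Lᵀ. -/
theorem costAt_eq_schur (hR : D.R.PosDef) (F : Matrix (Fin m) (Fin n) ℝ) :
    D.costAt F = D.schur + (F + D.R⁻¹ * D.Lᵀ)ᵀ * D.R * (F + D.R⁻¹ * D.Lᵀ) := by
  have hdet : IsUnit D.R.det := isUnit_iff_ne_zero.2 hR.det_pos.ne'
  have h1 : D.R⁻¹ * D.R = 1 := nonsing_inv_mul _ hdet
  have h2 : D.R * D.R⁻¹ = 1 := mul_nonsing_inv _ hdet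
  have hT : D.R⁻¹ᵀ = D.R⁻¹ := by rw [transpose_nonsing_inv, hR.transpose_eq]
  have h3 : D.R * (F + D.R⁻¹ * D.Lᵀ) = D.R * F + D.Lᵀ := by
    rw [Matrix.mul_add, ← Matrix.mul_assoc D.R D.R⁻¹, h2, Matrix.one_mul]
  rw [Matrix.mul_assoc, h3, transpose_add, transpose_mul, transpose_transpose, hT, Matrix.add_mul,
    Matrix.mul_add, Matrix.mul_add, Matrix.mul_assoc D.L _ (D.R * F), ← Matrix.mul_assoc D.R⁻¹, h1,
    Matrix.one_mul, costAt_eq, schur, ← Matrix.mul_assoc Fᵀ]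
  abel

/-- The kernel condition makes the feedback and the noise vanish on the kernel of the cost. -/
theorem KernelCondition.mulVec_eq_zero (hker : D.KernelCondition) (hR : D.R.PosDef)
    (hschur : D.schur.PosSemidef) {F : Matrix (Fin m) (Fin n) ℝ} {x : Fin n → ℝ}
    (hx : x ⬝ᵥ D.costAt F *ᵥ x ≤ 0) :
    D.schur *ᵥ x = 0 ∧ F *ᵥ x = 0 ∧ ∀ i, D.noise F i *ᵥ x = 0 := by
  rw [costAt_eq_schur hR, add_mulVec, dotProduct_add, quadForm_transpose_mul_mul] at hx
  have h1 := hschur.quadForm_nonneg x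
  have h2 := hR.posSemidef.quadForm_nonneg ((F + D.R⁻¹ * D.Lᵀ) *ᵥ x)
  have h3 : D.schur *ᵥ x = 0 := hschur.mulVec_eq_zero (by linarith)
  have h4 : (F + D.R⁻¹ * D.Lᵀ) *ᵥ x = 0 := by
    by_contra h
    linarith [hR.quadForm_pos h]
  obtain ⟨h5, h6⟩ := hker x h3
  have h7 : F *ᵥ x = 0 := by
    simpa [add_mulVec, ← mulVec_mulVec, h5] using h4
  refine ⟨h3, h7, fun i => ?_⟩
  simp [noise, add_mulVec, ← mulVec_mulVec, h6, h7]

/-- Subsolutions of the Riccati equation have a strict Lyapunov certificate for their closed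
loop. -/
theorem exists_certificate (hR : D.R.PosDef) (hcost : D.cost.PosSemidef)
    (hschur : D.schur.PosSemidef) (hker : D.KernelCondition)
    (hQA : DetectablePair D.schur D.A) {X : Matrix (Fin n) (Fin n) ℝ} (hX : X.PosSemidef)
    (hres : (-D.residual X).PosSemidef) :
    ∃ Y : Matrix (Fin n) (Fin n) ℝ, Y.PosDef ∧ (-D.closedLoopAdj (D.gain X) Y).PosDef := by
  obtain ⟨K, hK⟩ := hQA
  obtain ⟨W, hW, hWK⟩ := hK.exists_posDef
  set F := D.gain X
  have hP : -D.closedLoopAdj F X = -D.residual X + D.costAt F := by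
    rw [closedLoopAdj_gain hR hX]; abel
  have hPsd : (-D.closedLoopAdj F X).PosSemidef := by
    rw [hP]; exact hres.add (posSemidef_costAt hcost F)
  -- Where the form of -𝓛_F(X) vanishes, so do `schur`, `F` and the noise. There 𝓛_F(W) and the
  -- Lyapunov form of A + K·schur both reduce to that of A, which is negative.
  obtain ⟨c, hc, hcpos⟩ := hPsd.exists_smul_sub_posDef (S := D.closedLoopAdj F W)
    (lyapunovAdj_transpose _ _ hW.transpose_eq) fun x hx0 hx => by
      rw [hP, add_mulVec, dotProduct_add] at hx
      obtain ⟨h1, h2, h3⟩ := hker.mulVec_eq_zero hR hschur (F := F) (x := x)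
        (by linarith [hres.quadForm_nonneg x])
      have h4 := hWK.quadForm_pos hx0
      have h5 : (D.A + K * D.schur)ᵀ * W + W * (D.A + K * D.schur) =
          lyapunovAdj (D.A + K * D.schur) (fun i : Fin 0 => i.elim0) W := by
        simp [lyapunovAdj]
      rw [h5, neg_mulVec, dotProduct_neg, quadForm_lyapunovAdj _ _ hW.transpose_eq,
        add_mulVec, ← mulVec_mulVec, h1] at h4
      rw [closedLoopAdj, quadForm_lyapunovAdj _ _ hW.transpose_eq, add_mulVec, ← mulVec_mulVec, h2]
      simp only [h3]
      simp only [mulVec_zero, add_zero, dotProduct_zero, Finset.sum_const_zero,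
        Finset.univ_eq_empty, Finset.sum_empty] at h4 ⊢
      linarith
  refine ⟨W + c • X, hW.add_posSemidef (hX.smul hc), ?_⟩
  rw [closedLoopAdj, lyapunovAdj_add, lyapunovAdj_smul]
  convert hcpos using 1
  rw [closedLoopAdj, closedLoopAdj, smul_neg]
  abel

/-- Comparison principle for the deterministic part of the closed loop. -/
theorem posSemidef_of_Ahat (hR : D.R.PosDef) (hcost : D.cost.PosSemidef)
    (hschur : D.schur.PosSemidef) (hker : D.KernelCondition)
    (hQA : DetectablePair D.schur D.A) {X Z : Matrix (Fin n) (Fin n) ℝ} (hX : X.PosSemidef)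
    (hres : (-D.residual X).PosSemidef) (hZ : Zᵀ = Z)
    (h : (-((D.Ahat X)ᵀ * Z + Z * D.Ahat X)).PosSemidef) : Z.PosSemidef := by
  obtain ⟨Y, hY, hYneg⟩ := exists_certificate hR hcost hschur hker hQA hX hres
  rw [D.Ahat_eq hX.transpose_eq] at h
  refine posSemidef_of_neg_lyapunovAdj (D.A + D.B * D.gain X) (fun i : Fin 0 => i.elim0) hY ?_ hZ
    (by simpa [lyapunovAdj] using h)
  -- Removing the noise from 𝓛(Y) subtracts a positive semidefinite term, so `Y` also certifies the
  -- noise-free loop.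
  convert hYneg.add_posSemidef (D.posSemidef_sum_noise (D.gain X) hY.posSemidef) using 1
  simp [closedLoopAdj, lyapunovAdj]

end SCARE

/-! ### Monotone limits in the Loewner order. -/

theorem Matrix.isClosed_posSemidef {n : ℕ} :
    IsClosed {Z : Matrix (Fin n) (Fin n) ℝ | Z.PosSemidef} := by
  simp only [posSemidef_iff_real, Set.ofPred_and, Set.ofPred_forall]
  exact (isClosed_eq (by fun_prop) continuous_id).inter
    (isClosed_iInter fun x => isClosed_le continuous_const (by fun_prop))

/-- A sequence of matrices that decreases in the Loewner order and is bounded below converges. -/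
theorem Matrix.exists_tendsto_of_antitone {n : ℕ} {X : ℕ → Matrix (Fin n) (Fin n) ℝ}
    (hX : ∀ k, (X k)ᵀ = X k) (hanti : ∀ k, (X k - X (k + 1)).PosSemidef)
    {B : Matrix (Fin n) (Fin n) ℝ} (hB : ∀ k, (X k - B).PosSemidef) :
    ∃ Z, Tendsto X atTop (𝓝 Z) := by
  have hq : ∀ x : Fin n → ℝ, ∃ l, Tendsto (fun k => x ⬝ᵥ X k *ᵥ x) atTop (𝓝 l) := by
    intro x
    refine ⟨_, tendsto_atTop_ciInf (antitone_nat_of_succ_le fun k => ?_)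
      ⟨x ⬝ᵥ B *ᵥ x, ?_⟩⟩
    · have := (hanti k).quadForm_nonneg x
      rw [sub_mulVec, dotProduct_sub] at this
      linarith
    · rintro _ ⟨k, rfl⟩
      have := (hB k).quadForm_nonneg x
      rw [sub_mulVec, dotProduct_sub] at this
      dsimp only
      linarith
  have hij : ∀ i j, ∃ l, Tendsto (fun k => X k i j) atTop (𝓝 l) := by
    intro i j
    -- Polarization: each entry is a combination of three convergent quadratic forms.
    obtain ⟨a, ha⟩ := hq (Pi.single i 1 + Pi.single j 1)
    obtain ⟨b, hb⟩ := hq (Pi.single i 1)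
    obtain ⟨c, hc⟩ := hq (Pi.single j 1)
    refine ⟨(a - b - c) / 2, (((ha.sub hb).sub hc).div_const 2).congr fun k => ?_⟩
    have : X k j i = X k i j := congrFun (congrFun (hX k) i) j
    simp [mulVec_add, add_dotProduct, this]
    ring
  choose l hl using hij
  exact ⟨Matrix.of l, tendsto_pi_nhds.2 fun i => tendsto_pi_nhds.2 fun j => hl i j⟩

/-! ### The Newton iteration and its limit. -/

namespace SCARE

variable {n m r : ℕ} {D : SCARE n m r}

theorem continuousAt_Rc_inv (hR : D.R.PosDef) {X : Matrix (Fin n) (Fin n) ℝ}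
    (hX : X.PosSemidef) : ContinuousAt (fun Z => (D.Rc Z)⁻¹) X := by
  have h : Continuous D.Rc := by unfold Rc Pi22; fun_prop
  refine ContinuousAt.comp (f := D.Rc) (g := fun T => T⁻¹) ?_ h.continuousAt
  refine continuousAt_matrix_inv _ ?_
  simpa [Ring.inverse_eq_inv'] using continuousAt_inv₀ (posDef_Rc hR hX).det_pos.ne'

theorem continuousAt_Ahat (hR : D.R.PosDef) {X : Matrix (Fin n) (Fin n) ℝ} (hX : X.PosSemidef) :
    ContinuousAt D.Ahat X := by
  have h1 := continuousAt_Rc_inv hR hX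
  have h2 : Continuous D.Lc := by unfold Lc Pi12; fun_prop
  unfold Ahat Ac Gc
  fun_prop

theorem continuousAt_residual (hR : D.R.PosDef) {X : Matrix (Fin n) (Fin n) ℝ}
    (hX : X.PosSemidef) : ContinuousAt D.residual X := by
  have h1 : ContinuousAt (fun Z => (D.R + D.Pi22 Z)⁻¹) X := continuousAt_Rc_inv hR hX
  unfold residual Pi12 Pi11
  fun_prop

/-- Subtract the Newton equation from the completed square at the minimizing feedback: noise and
cost terms cancel. -/
theorem residual_eq_of_isModifiedNewton (hR : D.R.PosDef) {X : ℕ → Matrix (Fin n) (Fin n) ℝ}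
    (hX : D.IsModifiedNewton X) (hX_psd : ∀ k, (X k).PosSemidef) (k : ℕ) :
    D.residual (X k) =
      (D.Ahat (X k))ᵀ * (X k - X (k + 1)) + (X k - X (k + 1)) * D.Ahat (X k) := by
  have h1 := closedLoopAdj_gain hR (hX_psd k)
  have h2 := hX k
  rw [D.PiHat_eq, M_eq] at h2
  rw [closedLoopAdj, lyapunovAdj, ← D.Ahat_eq (hX_psd k).transpose_eq, eq_sub_iff_add_eq] at h1
  rw [← h1, ← sub_zero (_ + D.costAt _), ← h2]
  noncomm_ring

/-- The Newton step rewritten around the next iterate. -/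
theorem closedLoopAdj_succ_of_isModifiedNewton {X : ℕ → Matrix (Fin n) (Fin n) ℝ}
    (hX : D.IsModifiedNewton X) (hX_psd : ∀ k, (X k).PosSemidef) (k : ℕ)
    (Z : Matrix (Fin n) (Fin n) ℝ) :
    (D.Ahat (X k))ᵀ * (X (k + 1) - Z) + (X (k + 1) - Z) * D.Ahat (X k) +
      D.PiHat (X k) (X k - Z) =
      -(D.closedLoopAdj (D.gain (X k)) Z + D.costAt (D.gain (X k))) := by
  have h2 := hX k
  rw [M_eq] at h2
  rw [closedLoopAdj, lyapunovAdj, ← D.Ahat_eq (hX_psd k).transpose_eq, ← PiHat_eq]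
  have h3 : D.PiHat (X k) (X k - Z) = D.PiHat (X k) (X k) - D.PiHat (X k) Z := by
    simp only [PiHat_eq, Matrix.mul_sub, Matrix.sub_mul, Finset.sum_sub_distrib]
  rw [h3, ← sub_eq_zero, ← h2]
  noncomm_ring

theorem isModifiedNewton_invariant (hR : D.R.PosDef) (hcost : D.cost.PosSemidef)
    (hschur : D.schur.PosSemidef) (hker : D.KernelCondition) (hQA : DetectablePair D.schur D.A)
    {Xs : Matrix (Fin n) (Fin n) ℝ} (hXs : Xs.PosSemidef) (hXs_sol : D.residual Xs = 0)
    {X : ℕ → Matrix (Fin n) (Fin n) ℝ} (hX : D.IsModifiedNewton X)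
    (hX_psd : ∀ k, (X k).PosSemidef) {k : ℕ} (hge : (X k - Xs).PosSemidef)
    (hres : (-D.residual (X k)).PosSemidef) :
    (X k - X (k + 1)).PosSemidef ∧ (X (k + 1) - Xs).PosSemidef ∧
      (-D.residual (X (k + 1))).PosSemidef := by
  have hcomp {Z : Matrix (Fin n) (Fin n) ℝ} :=
    posSemidef_of_Ahat (Z := Z) hR hcost hschur hker hQA (hX_psd k) hres
  have hdec : (X k - X (k + 1)).PosSemidef := by
    refine hcomp (by simp [(hX_psd _).transpose_eq]) ?_
    rwa [← residual_eq_of_isModifiedNewton hR hX hX_psd]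
  have hsq (Y W : Matrix (Fin n) (Fin n) ℝ) (hY : Y.PosSemidef) :=
    (posDef_Rc hR hY).posSemidef.transpose_mul_mul (D.gain W - D.gain Y)
  refine ⟨hdec, hcomp (by simp [(hX_psd _).transpose_eq, hXs.transpose_eq]) ?_, ?_⟩
  -- With Z = X_*, the Lyapunov image of X_{k+1} - X_* is minus the noise image of X_k - X_* minus a
  -- square.
  · have h1 := closedLoopAdj_succ_of_isModifiedNewton hX hX_psd k Xs
    rw [closedLoopAdj_add_costAt hR hXs, hXs_sol, zero_add] at h1
    rw [eq_sub_of_add_eq h1, neg_sub, sub_neg_eq_add]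
    exact (D.posSemidef_PiHat _ hge).add (hsq Xs (X k) hXs)
  -- With Z = X_{k+1} the Lyapunov part drops out, leaving -ℛ(X_{k+1}) as the noise image of X_k -
  -- X_{k+1} plus a square.
  · have h1 := closedLoopAdj_succ_of_isModifiedNewton hX hX_psd k (X (k + 1))
    rw [closedLoopAdj_add_costAt hR (hX_psd _), sub_self, Matrix.mul_zero, Matrix.zero_mul,
      zero_add, zero_add, neg_add, eq_comm, ← eq_sub_iff_add_eq, sub_neg_eq_add] at h1
    rw [h1]
    exact (D.posSemidef_PiHat _ hdec).add (hsq (X (k + 1)) (X k) (hX_psd _))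

/-- A solution of the Riccati equation dominates every matrix with nonnegative residual. -/
theorem posSemidef_solution_sub (hR : D.R.PosDef) (hcost : D.cost.PosSemidef)
    (hschur : D.schur.PosSemidef) (hker : D.KernelCondition) (hQA : DetectablePair D.schur D.A)
    {Xs : Matrix (Fin n) (Fin n) ℝ} (hXs : Xs.PosSemidef) (hXs_sol : D.residual Xs = 0)
    {Z : Matrix (Fin n) (Fin n) ℝ} (hZ : Z.PosSemidef) (hZres : (D.residual Z).PosSemidef) :
    (Xs - Z).PosSemidef := by
  obtain ⟨Y, hY, hYneg⟩ := exists_certificate hR hcost hschur hker hQA hXs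
    (by rw [hXs_sol, neg_zero]; exact PosSemidef.zero)
  refine posSemidef_of_neg_lyapunovAdj _ _ hY hYneg
    (by simp [hXs.transpose_eq, hZ.transpose_eq]) ?_
  have h1 := closedLoopAdj_gain hR hXs
  have h2 := eq_sub_of_add_eq (closedLoopAdj_add_costAt hR hZ (D.gain Xs))
  -- Under the feedback of X_*, both matrices see the same cost, which cancels; only `Z` leaves a
  -- square.
  have h3 : -D.closedLoopAdj (D.gain Xs) (Xs - Z) = D.residual Z +
      (D.gain Xs - D.gain Z)ᵀ * D.Rc Z * (D.gain Xs - D.gain Z) := by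
    have : D.closedLoopAdj (D.gain Xs) (Xs - Z) =
      D.closedLoopAdj (D.gain Xs) Xs - D.closedLoopAdj (D.gain Xs) Z := lyapunovAdj_sub ..
    rw [this, h1, h2, hXs_sol]
    abel
  change (-D.closedLoopAdj (D.gain Xs) (Xs - Z)).PosSemidef
  rw [h3]
  exact hZres.add ((posDef_Rc hR hZ).posSemidef.transpose_mul_mul _)

end SCARE

theorem mainTheorem4 {n m r p : ℕ} (D : SCARE n m r) (C : Matrix (Fin p) (Fin n) ℝ)
    (hR : D.R.PosDef)
    (hcost : D.cost.PosSemidef)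
    (hstab : D.StochStabilizable)
    (hC : Cᵀ * C = D.schur)
    (hdet : D.StochDetectable C)
    (hker : D.KernelCondition)
    (hAB : StabilizablePair D.A D.B)
    (hQA : DetectablePair D.schur D.A)
    (Xs : Matrix (Fin n) (Fin n) ℝ)
    (hXs : Xs.PosSemidef)
    (hXs_sol : D.residual Xs = 0)
    (X : ℕ → Matrix (Fin n) (Fin n) ℝ)
    (hX : D.IsModifiedNewton X)
    (hX_psd : ∀ k, (X k).PosSemidef)
    (h0_ge : (X 0 - Xs).PosSemidef)
    (h0_stable : StableMatrix (D.Ac (X 0) - D.Gc (X 0) * X 0))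
    (h0_res : (-D.residual (X 0)).PosSemidef) :
    (∀ k, (X k - X (k + 1)).PosSemidef ∧ (X k - Xs).PosSemidef ∧
      (-D.residual (X k)).PosSemidef) ∧
    Tendsto X atTop (𝓝 Xs) := by
  have hschur : D.schur.PosSemidef := by
    rw [← hC]
    simpa using (PosSemidef.one (n := Fin p) (R := ℝ)).transpose_mul_mul C
  have hstep {k : ℕ} := SCARE.isModifiedNewton_invariant (k := k) hR hcost hschur hker hQA hXs
    hXs_sol hX hX_psd
  have hinv : ∀ k, (X k - Xs).PosSemidef ∧ (-D.residual (X k)).PosSemidef := by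
    intro k
    induction k with
    | zero => exact ⟨h0_ge, h0_res⟩
    | succ k ih => exact (hstep ih.1 ih.2).2
  have hanti : ∀ k, (X k - X (k + 1)).PosSemidef := fun k => (hstep (hinv k).1 (hinv k).2).1
  refine ⟨fun k => ⟨hanti k, hinv k⟩, ?_⟩
  obtain ⟨Z, hZ⟩ := exists_tendsto_of_antitone (fun k => (hX_psd k).transpose_eq) hanti
    fun k => (hinv k).1
  have hZ_psd : Z.PosSemidef :=
    isClosed_posSemidef.mem_of_tendsto hZ (Eventually.of_forall hX_psd)
  have hZ_ge : (Z - Xs).PosSemidef :=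
    isClosed_posSemidef.mem_of_tendsto (hZ.sub_const Xs) (Eventually.of_forall fun k => (hinv k).1)
  have hZ_res : D.residual Z = 0 := by
    have h1 := (SCARE.continuousAt_residual hR hZ_psd).tendsto.comp hZ
    have h2 := (SCARE.continuousAt_Ahat hR hZ_psd).tendsto.comp hZ
    have h3 : Tendsto (fun k => X k - X (k + 1)) atTop (𝓝 0) := by
      simpa using hZ.sub (hZ.comp (tendsto_add_atTop_nat 1))
    have h2t : Tendsto (fun k => (D.Ahat (X k))ᵀ) atTop (𝓝 (D.Ahat Z)ᵀ) :=
      (continuous_id.matrix_transpose.tendsto _).comp h2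
    have h4 := (h2t.mul h3).add (h3.mul h2)
    rw [Matrix.mul_zero, Matrix.zero_mul, add_zero] at h4
    refine tendsto_nhds_unique h1 (h4.congr fun k => ?_)
    exact (SCARE.residual_eq_of_isModifiedNewton hR hX hX_psd k).symm
  have hZ_le : (Xs - Z).PosSemidef :=
    SCARE.posSemidef_solution_sub hR hcost hschur hker hQA hXs hXs_sol hZ_psd
      (by rw [hZ_res]; exact PosSemidef.zero)
  have hZ_eq : Z = Xs := by
    have h0 : ∀ x, (Z - Xs) *ᵥ x = 0 := fun x => by
      refine hZ_ge.mulVec_eq_zero (le_antisymm ?_ (hZ_ge.quadForm_nonneg x))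
      have := hZ_le.quadForm_nonneg x
      rw [sub_mulVec, dotProduct_sub] at this ⊢
      linarith
    rw [← sub_eq_zero]
    exact ext_of_mulVec_single fun i => by rw [h0, zero_mulVec]
  rwa [← hZ_eq]
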